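/- Let $F$ be a field, let $A$ be a finitely generated torsion-free abelian group, and let $\lambda : A\times A\to F^*$ be a $2$-cocycle, i.e. $\lambda(a_1,a_2)\lambda(a_1a_2,a_3)=\lambda(a_2,a_3)\lambda(a_1,a_2a_3)$. Let $\mathcal A = F*A=\bigoplus_{a\in A}F\bar a$ be the twisted group algebra, with multiplication $\bar a_1\bar a_2=\lambda(a_1,a_2)\overline{a_1a_2}$. Let $B\le A$ be a subgroup such that $A/B$ is infinite cyclic, and let $\mathcal B=F*B\subseteq\mathcal A$ be the subalgebra of elements with support in $B$. The set $S=\mathcal B\setminus\{0\}$ is an Ore set in $\mathcal A$; let $\Sigma=\mathcal AS^{-1}\supseteq \mathcal A$ be the corresponding ring of fractions. For every maximal right ideal $\mathfrak m$ of $\Sigma$, the cyclic right $\mathcal A$-module $S(\mathfrak m)=\mathcal A/(\mathcal A\cap\mathfrak m)$ has Gelfand--Kirillov dimension $$\operatorname{GK}(S(\mathfrak m))=\operatorname{rk}(B).$$ Here, for a right $\mathcal A$-module $M$, $\operatorname{GK}(M)=\sup_{V,W}\limsup_{k\to\infty}\frac{\log\dim_F(WV^k)}{\log k}$, the supremum being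 over finite-dimensional subspaces $V\subseteq\mathcal A$ with $1\in V$ and $W\subseteq M$, and $\operatorname{rk}(B)$ is the rank of the free abelian group $B$. -/

import Mathlib

open scoped MulOpposite Pointwise

/-- A `2`-cocycle `lam : A × A → Fˣ` (trivial action of `A` on `F`), not necessarily normalised. -/
structure TwoCocycle (F A : Type*) [Field F] [CommGroup A] where
  toFun : A → A → Fˣ
  cocycle : ∀ a b c : A, toFun a b * toFun (a * b) c = toFun b c * toFun a (b * c)

namespace TwoCocycle

variable {F A : Type*} [Field F] [CommGroup A]

instance : CoeFun (TwoCocycle F A) (fun _ => A → A → Fˣ) := ⟨TwoCocycle.toFun⟩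

theorem one_left (lam : TwoCocycle F A) (a : A) : lam 1 a = lam 1 1 := by
  have h := lam.cocycle 1 1 a
  simp only [one_mul] at h
  exact (mul_right_cancel h).symm

theorem one_right (lam : TwoCocycle F A) (a : A) : lam a 1 = lam 1 1 := by
  have h := lam.cocycle a 1 1
  simp only [mul_one] at h
  exact mul_right_cancel h

end TwoCocycle

/-- The twisted group algebra `F * A`: the `F`-vector space with basis `(ā)_{a ∈ A}`. -/
def TwistedGroupAlgebra {F A : Type*} [Field F] [CommGroup A] (_lam : TwoCocycle F A) : Type _ :=
  A →₀ F

namespace TwistedGroupAlgebra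

variable {F A : Type*} [Field F] [CommGroup A] (lam : TwoCocycle F A)

noncomputable instance : AddCommGroup (TwistedGroupAlgebra lam) :=
  inferInstanceAs (AddCommGroup (A →₀ F))

noncomputable instance : Module F (TwistedGroupAlgebra lam) :=
  inferInstanceAs (Module F (A →₀ F))

/-- The homogeneous element `x ā`. -/
noncomputable def single (a : A) (x : F) : TwistedGroupAlgebra lam := Finsupp.single a x

/-- The basis element `ā`. -/
noncomputable def bar (a : A) : TwistedGroupAlgebra lam := single lam a 1

/-- The support in `A` of an element of `F * A`. -/
def supp {lam : TwoCocycle F A} (f : TwistedGroupAlgebra lam) : Finset A :=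
  Finsupp.support f

/-- The coefficient of `ā` in an element of `F * A`. -/
def coeff {lam : TwoCocycle F A} (f : TwistedGroupAlgebra lam) (a : A) : F :=
  (show A →₀ F from f) a

/-- The bilinear multiplication with `(x ā)(y b̄) = lam(a, b) x y \overline{ab}`, on coordinates. -/
noncomputable def mulAux : (A →₀ F) →ₗ[F] (A →₀ F) →ₗ[F] (A →₀ F) :=
  Finsupp.lsum F fun a => LinearMap.toSpanSingleton F ((A →₀ F) →ₗ[F] (A →₀ F))
    (Finsupp.lsum F fun b => (lam a b : F) • Finsupp.lsingle (a * b))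

theorem mulAux_single (a b : A) (x y : F) :
    mulAux lam (Finsupp.single a x) (Finsupp.single b y) =
      Finsupp.single (a * b) (lam a b * (x * y)) := by
  simp only [mulAux, Finsupp.lsum_single, LinearMap.toSpanSingleton_apply, LinearMap.smul_apply,
    Finsupp.lsingle_apply, Finsupp.smul_single, smul_eq_mul]
  congr 1
  ring

/-- The bilinear multiplication of `F * A`. -/
noncomputable def mulHom :
    TwistedGroupAlgebra lam →ₗ[F] TwistedGroupAlgebra lam →ₗ[F] TwistedGroupAlgebra lam :=
  mulAux lam

noncomputable instance : Mul (TwistedGroupAlgebra lam) := ⟨fun f g => mulHom lam f g⟩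

noncomputable instance : One (TwistedGroupAlgebra lam) :=
  ⟨single lam 1 ((lam 1 1)⁻¹ : Fˣ)⟩

theorem mul_def (f g : TwistedGroupAlgebra lam) : f * g = mulHom lam f g := rfl

theorem one_def : (1 : TwistedGroupAlgebra lam) = single lam 1 ((lam 1 1)⁻¹ : Fˣ) := rfl

theorem single_mul_single (a b : A) (x y : F) :
    single lam a x * single lam b y = single lam (a * b) (lam a b * (x * y)) :=
  mulAux_single lam a b x y

theorem bar_mul_bar (a b : A) :
    bar lam a * bar lam b = (lam a b : F) • bar lam (a * b) := by
  rw [bar, bar, single_mul_single]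
  refine Eq.trans ?_ (Finsupp.smul_single (lam a b : F) (a * b) (1 : F)).symm
  rw [smul_eq_mul, one_mul]
  rfl

@[elab_as_elim]
theorem induction_on {p : TwistedGroupAlgebra lam → Prop} (f : TwistedGroupAlgebra lam)
    (zero : p 0) (add : ∀ f g, p f → p g → p (f + g)) (single : ∀ a x, p (single lam a x)) :
    p f :=
  Finsupp.induction_linear (motive := p) f zero add single

protected theorem add_mul' (f g h : TwistedGroupAlgebra lam) :
    (f + g) * h = f * h + g * h := by
  simp only [mul_def, map_add, LinearMap.add_apply]

protected theorem mul_add' (f g h : TwistedGroupAlgebra lam) :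
    f * (g + h) = f * g + f * h := by
  simp only [mul_def, map_add]

protected theorem zero_mul' (f : TwistedGroupAlgebra lam) : 0 * f = 0 := by
  simp only [mul_def, map_zero, LinearMap.zero_apply]

protected theorem mul_zero' (f : TwistedGroupAlgebra lam) : f * 0 = 0 := by
  simp only [mul_def, map_zero]

noncomputable instance : Ring (TwistedGroupAlgebra lam) where
  __ := (inferInstance : AddCommGroup (TwistedGroupAlgebra lam))
  left_distrib := TwistedGroupAlgebra.mul_add' lam
  right_distrib := TwistedGroupAlgebra.add_mul' lam
  zero_mul := TwistedGroupAlgebra.zero_mul' lam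
  mul_zero := TwistedGroupAlgebra.mul_zero' lam
  mul_assoc f g h := by
    induction f using induction_on with
    | zero => simp only [TwistedGroupAlgebra.zero_mul']
    | add f₁ f₂ h₁ h₂ => simp only [TwistedGroupAlgebra.add_mul', h₁, h₂]
    | single a x =>
    induction g using induction_on with
    | zero => simp only [TwistedGroupAlgebra.zero_mul', TwistedGroupAlgebra.mul_zero']
    | add f₁ f₂ h₁ h₂ =>
      simp only [TwistedGroupAlgebra.add_mul', TwistedGroupAlgebra.mul_add', h₁, h₂]
    | single b y =>
    induction h using induction_on with
    | zero => simp only [TwistedGroupAlgebra.mul_zero']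
    | add f₁ f₂ h₁ h₂ => simp only [TwistedGroupAlgebra.mul_add', h₁, h₂]
    | single c z =>
    have h := congrArg (Units.val) (lam.cocycle a b c)
    simp only [Units.val_mul] at h
    simp only [single_mul_single, mul_assoc a b c]
    congr 1
    linear_combination x * y * z * h
  one_mul f := by
    induction f using induction_on with
    | zero => simp only [TwistedGroupAlgebra.mul_zero']
    | add f₁ f₂ h₁ h₂ => simp only [TwistedGroupAlgebra.mul_add', h₁, h₂]
    | single a x => simp [one_def, single_mul_single, lam.one_left a]
  mul_one f := by
    induction f using induction_on with
    | zero => simp only [TwistedGroupAlgebra.zero_mul']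
    | add f₁ f₂ h₁ h₂ => simp only [TwistedGroupAlgebra.add_mul', h₁, h₂]
    | single a x =>
      simp only [one_def, single_mul_single, lam.one_right a, mul_one]
      congr 1
      rw [mul_comm x, ← mul_assoc, Units.mul_inv, one_mul]

noncomputable instance : Algebra F (TwistedGroupAlgebra lam) :=
  Algebra.ofModule
    (fun r f g => by simp only [mul_def, map_smul, LinearMap.smul_apply])
    (fun r f g => by simp only [mul_def, map_smul])

variable {lam}

theorem mem_supp {f : TwistedGroupAlgebra lam} {a : A} : a ∈ supp f ↔ coeff f a ≠ 0 :=
  Finsupp.mem_support_iff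

theorem supp_eq_empty {f : TwistedGroupAlgebra lam} : supp f = ∅ ↔ f = 0 :=
  Finsupp.support_eq_empty

theorem supp_single_subset (a : A) (x : F) : supp (single lam a x) ⊆ {a} :=
  Finsupp.support_single_subset

open Classical in
theorem supp_add (f g : TwistedGroupAlgebra lam) : supp (f + g) ⊆ supp f ∪ supp g :=
  Finsupp.support_add

theorem coeff_sum {ι : Type*} (s : Finset ι) (f : ι → TwistedGroupAlgebra lam) (a : A) :
    coeff (∑ i ∈ s, f i) a = ∑ i ∈ s, coeff (f i) a :=
  map_sum (Finsupp.applyAddHom a : (A →₀ F) →+ F) f s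

theorem sum_single (f : TwistedGroupAlgebra lam) :
    ∑ a ∈ supp f, single lam a (coeff f a) = f :=
  Finsupp.sum_single f

theorem mul_eq_sum (f g : TwistedGroupAlgebra lam) :
    f * g = ∑ a ∈ supp f, ∑ b ∈ supp g,
      single lam (a * b) (lam a b * (coeff f a * coeff g b)) := by
  conv_lhs => rw [← sum_single f, ← sum_single g, Finset.sum_mul_sum]
  simp only [single_mul_single]

open Classical in
theorem supp_mul (f g : TwistedGroupAlgebra lam) : supp (f * g) ⊆ supp f * supp g := by
  intro c hc
  rw [mem_supp, mul_eq_sum, coeff_sum] at hc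
  obtain ⟨a, ha, h⟩ := Finset.exists_ne_zero_of_sum_ne_zero hc
  rw [coeff_sum] at h
  obtain ⟨b, hb, h⟩ := Finset.exists_ne_zero_of_sum_ne_zero h
  have := supp_single_subset _ _ (mem_supp.2 h)
  rw [Finset.mem_singleton] at this
  exact this ▸ Finset.mul_mem_mul ha hb

instance : Nontrivial (TwistedGroupAlgebra lam) :=
  inferInstanceAs (Nontrivial (A →₀ F))

instance [UniqueProds A] : NoZeroDivisors (TwistedGroupAlgebra lam) where
  eq_zero_or_eq_zero_of_mul_eq_zero {f g} hfg := by
    by_contra! h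
    have hf : (supp f).Nonempty := Finset.nonempty_iff_ne_empty.2 (mt supp_eq_empty.1 h.1)
    have hg : (supp g).Nonempty := Finset.nonempty_iff_ne_empty.2 (mt supp_eq_empty.1 h.2)
    obtain ⟨a, ha, b, hb, hu⟩ := UniqueProds.uniqueMul_of_nonempty hf hg
    have h0 : coeff (f * g) (a * b) = lam a b * (coeff f a * coeff g b) := by
      rw [mul_eq_sum, coeff_sum, Finset.sum_eq_single a, coeff_sum, Finset.sum_eq_single b]
      · exact Finsupp.single_eq_same
      · intro b' hb' hne
        refine Finsupp.single_eq_of_ne ?_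
        intro he
        exact hne (mul_left_cancel he).symm
      · intro hb'; exact (hb' hb).elim
      · intro a' ha' hne
        rw [coeff_sum]
        refine Finset.sum_eq_zero fun b' hb' => Finsupp.single_eq_of_ne ?_
        intro he
        exact hne (hu ha' hb' he.symm).1
      · intro ha'; exact (ha' ha).elim
    rw [hfg] at h0
    exact mul_ne_zero (lam a b).ne_zero (mul_ne_zero (mem_supp.1 ha) (mem_supp.1 hb)) h0.symm

variable (lam)

/-- The subalgebra `F * B` of the elements of `F * A` with support contained in `B`. -/
def sub (B : Subgroup A) : Subalgebra F (TwistedGroupAlgebra lam) where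
  carrier := {f | ∀ a ∈ supp f, a ∈ B}
  mul_mem' {f g} hf hg c hc := by
    classical
    obtain ⟨a, ha, b, hb, rfl⟩ := Finset.mem_mul.1 (supp_mul f g hc)
    exact B.mul_mem (hf a ha) (hg b hb)
  add_mem' {f g} hf hg c hc := by
    classical
    rcases Finset.mem_union.1 (supp_add f g hc) with h | h
    exacts [hf c h, hg c h]
  algebraMap_mem' r c hc := by
    have : supp (algebraMap F (TwistedGroupAlgebra lam) r) ⊆ {1} := by
      rw [Algebra.algebraMap_eq_smul_one, one_def]
      exact Finsupp.support_smul.trans Finsupp.support_single_subset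
    rw [Finset.mem_singleton.1 (this hc)]
    exact B.one_mem

/-- The multiplicative set `(F * B) \ {0}` of `F * A`. -/
def nonzeroSub [UniqueProds A] (B : Subgroup A) : Submonoid (TwistedGroupAlgebra lam) where
  carrier := {f | f ∈ sub lam B ∧ f ≠ 0}
  one_mem' := ⟨(sub lam B).one_mem, one_ne_zero⟩
  mul_mem' hf hg := ⟨(sub lam B).mul_mem hf.1 hg.1, mul_ne_zero hf.2 hg.2⟩

/-! ### The Ore condition, by counting dimensions -/

open Classical in
theorem card_pow_le (T : Finset A) (m : ℕ) : (T ^ m).card ≤ (m + 1) ^ T.card := by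
  have h : T ^ m ⊆ (Fintype.piFinset fun _ : T => Finset.range (m + 1)).image
      (fun e => ∏ g : T, (g : A) ^ e g) := by
    induction m with
    | zero =>
      intro a ha
      rw [pow_zero, Finset.mem_one] at ha
      exact Finset.mem_image.2 ⟨fun _ => 0, by simp, by simp [ha]⟩
    | succ m ih =>
      intro c hc
      rw [pow_succ] at hc
      obtain ⟨a, ha, b, hb, rfl⟩ := Finset.mem_mul.1 hc
      obtain ⟨e, he, rfl⟩ := Finset.mem_image.1 (ih ha)
      refine Finset.mem_image.2 ⟨e + Pi.single ⟨b, hb⟩ 1, ?_, ?_⟩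
      · rw [Fintype.mem_piFinset] at he ⊢
        intro g
        have := he g
        simp only [Finset.mem_range, Pi.add_apply] at this ⊢
        by_cases hg : g = ⟨b, hb⟩
        · subst hg; simp; omega
        · rw [Pi.single_eq_of_ne hg]; omega
      · simp only [Pi.add_apply, pow_add, Finset.prod_mul_distrib]
        congr 1
        rw [Finset.prod_eq_single ⟨b, hb⟩]
        · simp
        · intro g _ hg; rw [Pi.single_eq_of_ne hg, pow_zero]
        · simp
  refine (Finset.card_le_card h).trans (Finset.card_image_le.trans ?_)
  simp

open Classical in
theorem exists_folner (T : Finset A) (N : ℕ) :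
    ∃ m : ℕ, N * (T ^ (m + 1)).card < (N + 1) * (T ^ m).card := by
  by_contra! h
  have h1 : ∀ m : ℕ, (N + 1) ^ m ≤ N ^ m * (T ^ m).card := by
    intro m
    induction m with
    | zero => simp
    | succ m ih =>
      calc (N + 1) ^ (m + 1) = (N + 1) * (N + 1) ^ m := pow_succ' _ _
        _ ≤ (N + 1) * (N ^ m * (T ^ m).card) := Nat.mul_le_mul_left _ ih
        _ = N ^ m * ((N + 1) * (T ^ m).card) := by ring
        _ ≤ N ^ m * (N * (T ^ (m + 1)).card) := Nat.mul_le_mul_left _ (h m)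
        _ = _ := by ring
  rcases Nat.eq_zero_or_pos N with rfl | hN
  · have := h1 1
    simp at this
  have hN' : (0 : ℝ) < N := by exact_mod_cast hN
  set r : ℝ := (N + 1 : ℝ) / N with hr
  have hr1 : 1 < r := by rw [hr, one_lt_div hN']; linarith
  have h2 : ∀ m : ℕ, r ^ m ≤ ((m + 1 : ℕ) : ℝ) ^ T.card := by
    intro m
    rw [hr, div_pow, div_le_iff₀ (by positivity), mul_comm]
    have := (h1 m).trans (Nat.mul_le_mul_left _ (card_pow_le T m))
    exact_mod_cast this
  have h3 := (tendsto_pow_const_div_const_pow_of_one_lt T.card hr1).comp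
    (Filter.tendsto_add_atTop_nat 1)
  have h4 := h3.eventually (gt_mem_nhds (show (0 : ℝ) < 1 / r by positivity))
  obtain ⟨m, hm⟩ := h4.exists
  simp only [Function.comp_apply] at hm
  have hrp : 0 < r := by linarith
  rw [div_lt_div_iff₀ (by positivity) hrp, one_mul, pow_succ] at hm
  have := lt_of_mul_lt_mul_right hm hrp.le
  exact absurd (h2 m) (not_le.2 this)

theorem sub_finset_supported {f : TwistedGroupAlgebra lam} {X : Finset A} :
    (show A →₀ F from f) ∈ Finsupp.supported F F (X : Set A) ↔ supp f ⊆ X := by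
  rw [Finsupp.mem_supported]
  exact Finset.coe_subset

theorem exists_common_aux {M : Type*} [AddCommGroup M] [Module F M] (φ ψ : M →ₗ[F] M)
    {P Q R : Submodule F M} [FiniteDimensional F P] [FiniteDimensional F Q] [FiniteDimensional F R]
    (hφ : ∀ f ∈ P, φ f ∈ R) (hψ : ∀ f ∈ Q, ψ f ∈ R)
    (hlt : Module.finrank F R < Module.finrank F P + Module.finrank F Q) :
    ∃ u ∈ P, ∃ w ∈ Q, φ u = ψ w ∧ ¬(u = 0 ∧ w = 0) := by
  let Φ : (P × Q) →ₗ[F] R :=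
    ((φ.restrict hφ).comp (LinearMap.fst F P Q)) - ((ψ.restrict hψ).comp (LinearMap.snd F P Q))
  rw [← Module.finrank_prod] at hlt
  obtain ⟨p, hp, hp0⟩ := (Submodule.ne_bot_iff _).1 (LinearMap.ker_ne_bot_of_finrank_lt (f := Φ) hlt)
  refine ⟨p.1.1, p.1.2, p.2.1, p.2.2, ?_, ?_⟩
  · have := congrArg Subtype.val (LinearMap.mem_ker.1 hp)
    exact sub_eq_zero.1 this
  · intro h
    exact hp0 (Prod.ext (Subtype.ext h.1) (Subtype.ext h.2))

open Classical in
/-- Two `F`-linear endomorphisms of `F * A`, the first of which enlarges supports by a finite set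
`E` and the second by a finite subset of `B`, agree on some pair `(u, w) ≠ 0` with `u ∈ F * B`. -/
theorem exists_common (B : Subgroup A) (T E : Finset A) (hT : ∀ b ∈ T, b ∈ B)
    (φ ψ : TwistedGroupAlgebra lam →ₗ[F] TwistedGroupAlgebra lam)
    (hφ : ∀ f, supp (φ f) ⊆ supp f * E) (hψ : ∀ f, supp (ψ f) ⊆ supp f * T) :
    ∃ u w, u ∈ sub lam B ∧ φ u = ψ w ∧ (u ≠ 0 ∨ w ≠ 0) := by
  set T' := insert 1 T with hT'
  have h1 : (1 : A) ∈ T' := Finset.mem_insert_self _ _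
  have hT'B : ∀ b ∈ T', b ∈ B := by
    intro b hb
    rcases Finset.mem_insert.1 hb with rfl | hb
    exacts [B.one_mem, hT b hb]
  have hpow : ∀ m : ℕ, ∀ b ∈ T' ^ m, b ∈ B := by
    intro m
    induction m with
    | zero => intro b hb; rw [pow_zero, Finset.mem_one] at hb; exact hb ▸ B.one_mem
    | succ m ih =>
      intro c hc
      rw [pow_succ] at hc
      obtain ⟨a, ha, b, hb, rfl⟩ := Finset.mem_mul.1 hc
      exact B.mul_mem (ih a ha) (hT'B b hb)
  obtain ⟨m, hm⟩ := exists_folner T' E.card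
  have hsub : T' ^ m ⊆ T' ^ (m + 1) := Finset.pow_subset_pow_right h1 (Nat.le_succ m)
  set X := T' ^ m with hX
  set Y := T' ^ (m + 1) with hY
  have hcard : (Y * E).card < X.card + (X * E).card := by
    have e1 : Y * E ⊆ X * E ∪ (Y \ X) * E := by
      rw [← Finset.union_mul, Finset.union_sdiff_of_subset hsub]
    have e2 := (Finset.card_le_card e1).trans (Finset.card_union_le _ _)
    have e3 : ((Y \ X) * E).card ≤ (Y \ X).card * E.card := Finset.card_mul_le
    have e4 := Finset.card_sdiff_add_card_eq_card hsub
    rw [← e4] at hm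
    nlinarith
  have fr : ∀ Z : Finset A, Module.finrank F (Finsupp.supported F F (Z : Set A)) = Z.card := by
    intro Z
    rw [(Finsupp.supportedEquivFinsupp (M := F) (R := F) (Z : Set A)).finrank_eq]
    simp
  have fd : ∀ Z : Finset A, FiniteDimensional F (Finsupp.supported F F (Z : Set A)) := fun Z =>
    Module.Finite.equiv (Finsupp.supportedEquivFinsupp (M := F) (R := F) (Z : Set A)).symm
  have := fd X
  have := fd (X * E)
  have := fd (Y * E)
  let φ' : (A →₀ F) →ₗ[F] (A →₀ F) := φ
  let ψ' : (A →₀ F) →ₗ[F] (A →₀ F) := ψ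
  have hXT : X * T' = Y := by rw [hX, hY, pow_succ]
  have a1 : ∀ f ∈ Finsupp.supported F F (X : Set A),
      φ' f ∈ Finsupp.supported F F ((Y * E : Finset A) : Set A) := by
    intro f hf
    refine (sub_finset_supported lam).2 ((hφ f).trans ?_)
    exact Finset.mul_subset_mul_right (((sub_finset_supported lam).1 hf).trans hsub)
  have a2 : ∀ f ∈ Finsupp.supported F F ((X * E : Finset A) : Set A),
      ψ' f ∈ Finsupp.supported F F ((Y * E : Finset A) : Set A) := by
    intro f hf
    refine (sub_finset_supported lam).2 ((hψ f).trans ?_)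
    refine (Finset.mul_subset_mul ((sub_finset_supported lam).1 hf)
      (Finset.subset_insert 1 T)).trans ?_
    rw [mul_right_comm, ← hT', hXT]
  obtain ⟨u, hu, w, hw, h, h0⟩ := exists_common_aux φ' ψ' a1 a2
    (by rw [fr, fr, fr]; exact hcard)
  refine ⟨u, w, ?_, h, ?_⟩
  · intro b hb
    exact hpow m b ((sub_finset_supported lam).1 hu hb)
  · exact not_and_or.1 h0

theorem ore_left [UniqueProds A] (B : Subgroup A) (a : TwistedGroupAlgebra lam)
    (s : nonzeroSub lam B) : ∃ (a' : TwistedGroupAlgebra lam) (s' : nonzeroSub lam B),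
      (s' : TwistedGroupAlgebra lam) * a = a' * s := by
  classical
  obtain ⟨u, w, hu, h, h0⟩ := exists_common lam B (supp s.1) (supp a) s.2.1
    (LinearMap.mulRight F a) (LinearMap.mulRight F s.1)
    (fun f => supp_mul f a) (fun f => supp_mul f s.1)
  simp only [LinearMap.mulRight_apply] at h
  refine ⟨w, ⟨u, hu, ?_⟩, h⟩
  rintro rfl
  rw [zero_mul] at h
  rcases mul_eq_zero.1 h.symm with hw | hs
  · simp [hw] at h0
  · exact s.2.2 hs

theorem ore_right [UniqueProds A] (B : Subgroup A) (a : TwistedGroupAlgebra lam)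
    (s : nonzeroSub lam B) : ∃ (a' : TwistedGroupAlgebra lam) (s' : nonzeroSub lam B),
      a * (s' : TwistedGroupAlgebra lam) = s * a' := by
  classical
  obtain ⟨u, w, hu, h, h0⟩ := exists_common lam B (supp s.1) (supp a) s.2.1
    (LinearMap.mulLeft F a) (LinearMap.mulLeft F s.1)
    (fun f => (supp_mul a f).trans (mul_comm _ _).le)
    (fun f => (supp_mul s.1 f).trans (mul_comm _ _).le)
  simp only [LinearMap.mulLeft_apply] at h
  refine ⟨w, ⟨u, hu, ?_⟩, h⟩
  rintro rfl
  rw [mul_zero] at h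
  rcases mul_eq_zero.1 h.symm with hs | hw
  · exact s.2.2 hs
  · simp [hw] at h0

noncomputable instance [UniqueProds A] (B : Subgroup A) :
    OreLocalization.OreSet (nonzeroSub lam B) :=
  OreLocalization.oreSetOfNoZeroDivisors
    (fun a s => (ore_left lam B a s).choose)
    (fun a s => (ore_left lam B a s).choose_spec.choose)
    (fun a s => (ore_left lam B a s).choose_spec.choose_spec)

/-- The ring of fractions `Σ` of `𝒜 = F * A` at the two-sided Ore set `S = (F * B) \ {0}`. Mathlib
writes its elements as left fractions `s⁻¹ a`; by `sigma_eq_right_fraction` they are exactly the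
right fractions `a s⁻¹`. -/
abbrev Sigma [UniqueProds A] (B : Subgroup A) : Type _ :=
  OreLocalization (nonzeroSub lam B) (TwistedGroupAlgebra lam)

/-- The canonical embedding `𝒜 → Σ`. -/
noncomputable abbrev toSigma [UniqueProds A] (B : Subgroup A) :
    TwistedGroupAlgebra lam →+* Sigma lam B :=
  OreLocalization.numeratorRingHom

theorem toSigma_injective [UniqueProds A] (B : Subgroup A) :
    Function.Injective (toSigma lam B) :=
  OreLocalization.numeratorHom_inj fun _ hs _ hx =>
    (mul_eq_zero.1 hx).resolve_left hs.2

theorem isUnit_toSigma [UniqueProds A] (B : Subgroup A) (s : nonzeroSub lam B) :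
    IsUnit (toSigma lam B s) :=
  OreLocalization.numerator_isUnit s

theorem sigma_eq_right_fraction [UniqueProds A] (B : Subgroup A) (x : Sigma lam B) :
    ∃ (a : TwistedGroupAlgebra lam) (s : nonzeroSub lam B),
      x * toSigma lam B s = toSigma lam B a := by
  induction x using OreLocalization.ind with
  | _ a s =>
  obtain ⟨a', s', h⟩ := ore_right lam B a s
  refine ⟨a', s', ?_⟩
  apply (isUnit_toSigma lam B s).mul_right_injective
  change toSigma lam B s * ((a /ₒ s) * toSigma lam B s') = toSigma lam B s * toSigma lam B a'
  have hs : toSigma lam B s * (a /ₒ s) = toSigma lam B a := by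
    change ((s : TwistedGroupAlgebra lam) /ₒ 1) * (a /ₒ s) = a /ₒ 1
    exact OreLocalization.mul_cancel
  rw [← mul_assoc, hs, ← map_mul, ← map_mul, h]

end TwistedGroupAlgebra

/-- The contraction `f⁻¹(𝔪)` of a right ideal `𝔪` along a ring homomorphism `f`; right ideals are
submodules over the opposite ring. -/
def contractRightIdeal {R R' : Type*} [Ring R] [Ring R'] (f : R →+* R') (m : Submodule R'ᵐᵒᵖ R') :
    Submodule Rᵐᵒᵖ R where
  carrier := {x | f x ∈ m}
  zero_mem' := by simp
  add_mem' {x y} hx hy := by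
    simpa using m.add_mem hx hy
  smul_mem' r x hx := by
    have := m.smul_mem (MulOpposite.op (f r.unop)) hx
    simpa [MulOpposite.smul_eq_mul_unop] using this

/-- The subspace `W V ^ k` of a right `R`-module `M`, for subspaces `W ⊆ M` and `V ⊆ R`. -/
def growthSubspace {F R M : Type*} [Field F] [Ring R] [Algebra F R] [AddCommGroup M] [Module F M]
    [Module Rᵐᵒᵖ M] (V : Submodule F R) (W : Submodule F M) (k : ℕ) : Submodule F M :=
  Submodule.span F {x | ∃ w ∈ W, ∃ v ∈ V ^ k, x = MulOpposite.op v • w}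

/-- The Gelfand--Kirillov dimension of a right `R`-module `M` over an `F`-algebra `R`: the supremum
of `limsup_k log (dim_F (W V ^ k)) / log k` over all finite-dimensional subspaces `V ∋ 1` of `R` and
`W` of `M`. -/
noncomputable def gkDim (F R M : Type*) [Field F] [Ring R] [Algebra F R] [AddCommGroup M]
    [Module F M] [Module Rᵐᵒᵖ M] [IsScalarTower F Rᵐᵒᵖ M] : EReal :=
  ⨆ (V : Submodule F R) (_ : FiniteDimensional F V) (_ : (1 : R) ∈ V)
    (W : Submodule F M) (_ : FiniteDimensional F W),
    Filter.limsup (fun k : ℕ =>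
      ((Real.log (Module.finrank F (growthSubspace V W k)) / Real.log k : ℝ) : EReal)) Filter.atTop

/-- The rank of a finitely generated (torsion-free) abelian group. -/
noncomputable def groupRk (G : Type*) [CommGroup G] : ℕ := Module.finrank ℤ (Additive G)

namespace TwistedGroupAlgebra

variable {F A : Type*} [Field F] [CommGroup A] (lam : TwoCocycle F A)

/-- The cyclic right `𝒜`-module `S(𝔪) = 𝒜 / (𝒜 ∩ 𝔪)` for a right ideal `𝔪` of `Σ`. -/
abbrev contracted [UniqueProds A] (B : Subgroup A)
    (m : Submodule (Sigma lam B)ᵐᵒᵖ (Sigma lam B)) : Type _ :=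
  TwistedGroupAlgebra lam ⧸ contractRightIdeal (toSigma lam B) m

end TwistedGroupAlgebra

/-!
Write `n = rk A`, `r = rk B`, so that `n = r + 1`, and let `I` be the contraction of `𝔪` to
`𝒜 = F * A`. Only two consequences of the maximality of `𝔪` matter.

* `I ≠ 0`. The ring `Σ` is not a division ring: if `x ∈ A` maps to a generator of `A / B ≅ ℤ`, the
  element `1 + x̄` is not invertible, because in the grading of `𝒜` by `A / B` none of its nonzero
  multiples is homogeneous (`one_add_bar_mul_notMem_nonzeroSub`). Hence `𝔪 ≠ 0`
  (`bot_not_isCoatom`), and clearing denominators gives a nonzero element of `I`.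
* `I ∩ (F * B) = 0`, because the nonzero elements of `F * B` are units of `Σ` and `𝔪` is proper
  (`eq_zero_of_mem_contractRightIdeal`).

For the upper bound, choose `0 ≠ f ∈ I` with support in the box of radius `c` of `A ≅ ℤⁿ`. As `𝒜` is
a domain, `u ↦ f u` embeds the span of the box of radius `N` in the intersection of `I` with the
span of the box of radius `N + c`, so the image of the latter in `𝒜 / I` has dimension at most
`(2 (N + c) + 1) ^ n - (2 N + 1) ^ n = O(N ^ (n - 1))` (`finrank_map_quotMap_add_le`). Every
`W V ^ k` lies in such an image with `N` linear in `k`, whence `GK(𝒜 / I) ≤ n - 1 = r`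
(`gkDim_quotient_le`).

For the lower bound, `F * B` embeds in `𝒜 / I` through the class of `1`, and the spans of the boxes
of `B ≅ ℤʳ` already have dimension `(2 k + 1) ^ r` (`le_gkDim_quotient`).
-/

/-! ### Boxes in free abelian groups -/

section LatticeBox

variable {G ι : Type*} [CommGroup G] [Fintype ι] (b : Module.Basis ι ℤ (Additive G))

open Classical in
/-- The box of radius `k` in a free abelian group: the elements all of whose coordinates in the
basis `b` lie in `[-k, k]`. -/
noncomputable def latticeBox (k : ℕ) : Finset G :=
  (Fintype.piFinset fun _ : ι => Finset.Icc (-(k : ℤ)) k).map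
    (b.equivFun.symm.toEquiv.trans Additive.toMul).toEmbedding

theorem mem_latticeBox {k : ℕ} {a : G} :
    a ∈ latticeBox b k ↔ ∀ i, |b.repr (Additive.ofMul a) i| ≤ k := by
  simp only [latticeBox, Finset.mem_map_equiv, Fintype.mem_piFinset, Finset.mem_Icc, abs_le]
  rfl

theorem card_latticeBox (k : ℕ) : (latticeBox b k).card = (2 * k + 1) ^ Fintype.card ι := by
  classical
  rw [latticeBox, Finset.card_map, Fintype.card_piFinset, Finset.prod_const, Finset.card_univ,
    Int.card_Icc]
  congr 1
  omega

theorem latticeBox_mono : Monotone (latticeBox b) := by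
  intro k l h a ha
  rw [mem_latticeBox] at ha ⊢
  intro i
  have := ha i
  omega

theorem one_mem_latticeBox (k : ℕ) : (1 : G) ∈ latticeBox b k := by
  simp [mem_latticeBox]

theorem mul_mem_latticeBox {k l : ℕ} {x y : G} (hx : x ∈ latticeBox b k)
    (hy : y ∈ latticeBox b l) : x * y ∈ latticeBox b (k + l) := by
  rw [mem_latticeBox] at hx hy ⊢
  intro i
  rw [ofMul_mul, map_add, Finsupp.add_apply, Nat.cast_add]
  exact (abs_add_le _ _).trans (add_le_add (hx i) (hy i))

theorem latticeBox_mul_subset [DecidableEq G] (k l : ℕ) :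
    latticeBox b k * latticeBox b l ⊆ latticeBox b (k + l) := by
  intro c hc
  obtain ⟨x, hx, y, hy, rfl⟩ := Finset.mem_mul.1 hc
  exact mul_mem_latticeBox b hx hy

theorem latticeBox_pow_subset [DecidableEq G] (d k : ℕ) :
    latticeBox b d ^ k ⊆ latticeBox b (d * k) := by
  induction k with
  | zero => simpa using one_mem_latticeBox b 0
  | succ k ih =>
    rw [pow_succ]
    exact (Finset.mul_subset_mul_right ih).trans (latticeBox_mul_subset b _ _)

theorem latticeBox_subset_pow [DecidableEq G] (k : ℕ) : latticeBox b k ⊆ latticeBox b 1 ^ k := by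
  induction k with
  | zero =>
    intro a ha
    rw [mem_latticeBox] at ha
    have : b.repr (Additive.ofMul a) = 0 := by
      ext i
      simpa using ha i
    have h0 : Additive.ofMul a = 0 := by simpa using this
    rw [pow_zero, Finset.mem_one]
    exact ofMul_eq_zero.1 h0
  | succ k ih =>
    intro a ha
    rw [mem_latticeBox] at ha
    -- split off the vector of signs of the coordinates
    set s : G := Additive.toMul (b.equivFun.symm fun i => (b.repr (Additive.ofMul a) i).sign)
      with hs
    have hrep : ∀ i, b.repr (Additive.ofMul s) i = (b.repr (Additive.ofMul a) i).sign := by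
      intro i
      have := congrFun (b.equivFun.apply_symm_apply
        (fun i => (b.repr (Additive.ofMul a) i).sign)) i
      exact this
    rw [pow_succ, Finset.mem_mul]
    refine ⟨a / s, ih ?_, s, ?_, div_mul_cancel a s⟩
    · rw [mem_latticeBox]
      intro i
      rw [ofMul_div, map_sub, Finsupp.sub_apply, hrep]
      have h := ha i
      push_cast at h
      rcases lt_trichotomy (b.repr (Additive.ofMul a) i) 0 with h0 | h0 | h0
      · rw [Int.sign_eq_neg_one_of_neg h0]; rw [abs_le] at h ⊢; omega
      · rw [h0]; simp
      · rw [Int.sign_eq_one_of_pos h0]; rw [abs_le] at h ⊢; omega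
    · rw [mem_latticeBox]
      intro i
      rw [hrep]
      rcases lt_trichotomy (b.repr (Additive.ofMul a) i) 0 with h0 | h0 | h0
      · rw [Int.sign_eq_neg_one_of_neg h0]; simp
      · rw [h0]; simp
      · rw [Int.sign_eq_one_of_pos h0]; simp

theorem exists_subset_latticeBox (X : Finset G) : ∃ k, X ⊆ latticeBox b k := by
  refine ⟨X.sup fun a => Finset.univ.sup fun i => (b.repr (Additive.ofMul a) i).natAbs, ?_⟩
  intro a ha
  rw [mem_latticeBox]
  intro i
  rw [Int.abs_eq_natAbs, Nat.cast_le]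
  exact (Finset.le_sup (f := fun i => (b.repr (Additive.ofMul a) i).natAbs)
    (Finset.mem_univ i)).trans
    (Finset.le_sup (f := fun a => Finset.univ.sup fun i => (b.repr (Additive.ofMul a) i).natAbs) ha)

end LatticeBox

/-! ### Subspaces of elements with prescribed support -/

namespace TwistedGroupAlgebra

variable {F A : Type*} [Field F] [CommGroup A] (lam : TwoCocycle F A)

/-- The subspace of the elements of `F * A` with support in `X`. -/
def supportedOn (X : Finset A) : Submodule F (TwistedGroupAlgebra lam) :=
  Finsupp.supported F F (X : Set A)

theorem mem_supportedOn {X : Finset A} {f : TwistedGroupAlgebra lam} :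
    f ∈ supportedOn lam X ↔ supp f ⊆ X :=
  sub_finset_supported lam

theorem supportedOn_mono : Monotone (supportedOn lam) := fun _ _ h _ hf =>
  (mem_supportedOn lam).2 (((mem_supportedOn lam).1 hf).trans h)

theorem finrank_supportedOn (X : Finset A) : Module.finrank F (supportedOn lam X) = X.card := by
  refine (Finsupp.supportedEquivFinsupp (M := F) (R := F) (X : Set A)).finrank_eq.trans ?_
  simp

instance (X : Finset A) : FiniteDimensional F (supportedOn lam X) :=
  Module.Finite.equiv (Finsupp.supportedEquivFinsupp (M := F) (R := F) (X : Set A)).symm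

theorem single_mem_supportedOn {X : Finset A} {a : A} (ha : a ∈ X) (x : F) :
    single lam a x ∈ supportedOn lam X :=
  (mem_supportedOn lam).2 ((supp_single_subset a x).trans (Finset.singleton_subset_iff.2 ha))

theorem one_mem_supportedOn {X : Finset A} (h : (1 : A) ∈ X) :
    (1 : TwistedGroupAlgebra lam) ∈ supportedOn lam X :=
  one_def lam ▸ single_mem_supportedOn lam h _

open Classical in
theorem supportedOn_mul (X Y : Finset A) :
    supportedOn lam X * supportedOn lam Y = supportedOn lam (X * Y) := by
  apply le_antisymm
  · rw [Submodule.mul_le]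
    intro f hf g hg
    rw [mem_supportedOn] at hf hg ⊢
    exact (supp_mul f g).trans (Finset.mul_subset_mul hf hg)
  · intro f hf
    rw [mem_supportedOn] at hf
    rw [← sum_single f]
    refine Submodule.sum_mem _ fun c hc => ?_
    obtain ⟨a, ha, b, hb, rfl⟩ := Finset.mem_mul.1 (hf hc)
    have h : single lam (a * b) (coeff f (a * b)) =
        single lam a (((lam a b)⁻¹ : Fˣ) : F) * single lam b (coeff f (a * b)) := by
      rw [single_mul_single, ← mul_assoc, Units.mul_inv, one_mul]
    rw [h]
    exact Submodule.mul_mem_mul (single_mem_supportedOn lam ha _) (single_mem_supportedOn lam hb _)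

open Classical in
theorem supportedOn_pow (X : Finset A) (k : ℕ) :
    supportedOn lam X ^ k = supportedOn lam (X ^ k) := by
  induction k with
  | zero =>
    rw [pow_zero, pow_zero]
    apply le_antisymm
    · rw [Submodule.one_le]
      exact one_mem_supportedOn lam (Finset.mem_one.2 rfl)
    · intro f hf
      rw [mem_supportedOn] at hf
      rw [← sum_single f]
      refine Submodule.sum_mem _ fun c hc => ?_
      rw [Finset.mem_one.1 (hf hc), Submodule.mem_one]
      refine ⟨lam 1 1 * coeff f 1, ?_⟩
      rw [Algebra.algebraMap_eq_smul_one, one_def]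
      refine (Finsupp.smul_single _ _ _).trans ?_
      rw [smul_eq_mul, mul_right_comm, Units.mul_inv, one_mul]
      rfl
  | succ k ih => rw [pow_succ, pow_succ, ih, supportedOn_mul]

theorem exists_le_supportedOn (V : Submodule F (TwistedGroupAlgebra lam)) [FiniteDimensional F V] :
    ∃ X : Finset A, V ≤ supportedOn lam X := by
  classical
  obtain ⟨S, hS⟩ := (Module.Finite.iff_fg.1 (inferInstance : Module.Finite F V))
  refine ⟨S.biUnion supp, ?_⟩
  rw [← hS, Submodule.span_le]
  intro f hf
  exact (mem_supportedOn lam).2 (Finset.subset_biUnion_of_mem supp hf)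

/-! ### Counting in cyclic modules -/

section Cyclic

variable (I : Submodule (TwistedGroupAlgebra lam)ᵐᵒᵖ (TwistedGroupAlgebra lam))

/-- The projection of `F * A` onto the cyclic module `(F * A) / I`, as an `F`-linear map. -/
noncomputable def quotMap : TwistedGroupAlgebra lam →ₗ[F] TwistedGroupAlgebra lam ⧸ I :=
  I.mkQ.restrictScalars F

theorem quotMap_surjective : Function.Surjective (quotMap lam I) := I.mkQ_surjective

theorem quotMap_eq_zero {f : TwistedGroupAlgebra lam} : quotMap lam I f = 0 ↔ f ∈ I :=
  Submodule.Quotient.mk_eq_zero I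

theorem op_smul_quotMap (v w : TwistedGroupAlgebra lam) :
    MulOpposite.op v • quotMap lam I w = quotMap lam I (w * v) :=
  (I.mkQ.map_smul (MulOpposite.op v) w).symm

/-- A right ideal `I` containing `f ≠ 0` contains `f u` for every `u`, and `u ↦ f u` is injective,
so the image in `(F * A) / I` of a large box has at most the dimension by which this box exceeds
a slightly smaller one. -/
theorem finrank_map_quotMap_add_le [UniqueProds A] {ι : Type*} [Fintype ι]
    (b : Module.Basis ι ℤ (Additive A)) {f : TwistedGroupAlgebra lam} (hf : f ∈ I) (hf0 : f ≠ 0)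
    {c : ℕ} (hc : supp f ⊆ latticeBox b c) (N : ℕ) :
    Module.finrank F ((supportedOn lam (latticeBox b (N + c))).map (quotMap lam I)) +
      (2 * N + 1) ^ Fintype.card ι ≤ (2 * (N + c) + 1) ^ Fintype.card ι := by
  classical
  set P := supportedOn lam (latticeBox b (N + c)) with hP
  have hrn := ((quotMap lam I).domRestrict P).finrank_range_add_finrank_ker
  rw [LinearMap.range_domRestrict, finrank_supportedOn, card_latticeBox] at hrn
  rw [← hrn]
  refine Nat.add_le_add_left ?_ _
  have hmem : ∀ u : supportedOn lam (latticeBox b N), f * u ∈ P := by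
    intro u
    have h := Submodule.mul_mem_mul ((mem_supportedOn lam).2 hc) u.2
    rw [supportedOn_mul] at h
    exact supportedOn_mono lam
      ((latticeBox_mul_subset b c N).trans (by rw [add_comm])) h
  let g : supportedOn lam (latticeBox b N) →ₗ[F] P :=
    LinearMap.codRestrict P ((LinearMap.mulLeft F f).domRestrict _) hmem
  have hg : ∀ u, g u ∈ ((quotMap lam I).domRestrict P).ker := by
    intro u
    rw [LinearMap.mem_ker]
    exact (quotMap_eq_zero lam I).2 (I.smul_mem (MulOpposite.op u.1) hf)
  rw [← card_latticeBox b N, ← finrank_supportedOn lam]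
  refine LinearMap.finrank_le_finrank_of_injective (f := LinearMap.codRestrict _ g hg) ?_
  intro u v huv
  have h : f * u.1 = f * v.1 :=
    congrArg (fun z => ((z : P) : TwistedGroupAlgebra lam)) (congrArg Subtype.val huv)
  exact Subtype.ext (mul_left_cancel₀ hf0 h)

theorem growthSubspace_le_map_quotMap {V W : Submodule F (TwistedGroupAlgebra lam)}
    {W' : Submodule F (TwistedGroupAlgebra lam ⧸ I)} (hW : W' ≤ W.map (quotMap lam I)) (k : ℕ) :
    growthSubspace V W' k ≤ (W * V ^ k).map (quotMap lam I) := by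
  rw [growthSubspace, Submodule.span_le]
  rintro _ ⟨w', hw', v, hv, rfl⟩
  obtain ⟨w, hw, rfl⟩ := hW hw'
  exact ⟨w * v, Submodule.mul_mem_mul hw hv, (op_smul_quotMap lam I v w).symm⟩

theorem exists_le_map_quotMap (W : Submodule F (TwistedGroupAlgebra lam ⧸ I))
    [FiniteDimensional F W] :
    ∃ X : Finset A, W ≤ (supportedOn lam X).map (quotMap lam I) := by
  classical
  obtain ⟨S, hS⟩ := (Module.Finite.iff_fg.1 (inferInstance : Module.Finite F W))
  let g := Function.surjInv (quotMap_surjective lam I)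
  refine ⟨S.biUnion fun w => supp (g w), ?_⟩
  rw [← hS, Submodule.span_le]
  intro w hw
  refine ⟨g w, (mem_supportedOn lam).2 ?_, Function.surjInv_eq (quotMap_surjective lam I) w⟩
  exact Finset.subset_biUnion_of_mem (fun w => supp (g w)) hw

end Cyclic

end TwistedGroupAlgebra

/-! ### Growth exponents of sequences -/

theorem limsup_log_div_log_le {d : ℕ → ℕ} {C r : ℕ} (hC : C ≠ 0)
    (h : ∀ᶠ k in Filter.atTop, d k ≤ C * k ^ r) :
    Filter.limsup (fun k : ℕ => ((Real.log (d k) / Real.log k : ℝ) : EReal)) Filter.atTop ≤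
      ((r : ℝ) : EReal) := by
  have ht : Filter.Tendsto (fun k : ℕ => ((Real.log C / Real.log k + r : ℝ) : EReal)) Filter.atTop
      (nhds ((r : ℝ) : EReal)) := by
    refine (continuous_coe_real_ereal.tendsto _).comp ?_
    have h1 : Filter.Tendsto (fun k : ℕ => Real.log k) Filter.atTop Filter.atTop :=
      Real.tendsto_log_atTop.comp tendsto_natCast_atTop_atTop
    simpa using (h1.const_div_atTop (Real.log C)).add_const (r : ℝ)
  rw [← ht.limsup_eq]
  refine Filter.limsup_le_limsup ?_
  filter_upwards [h, Filter.eventually_ge_atTop 2] with k hk hk2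
  rw [EReal.coe_le_coe_iff]
  have hk1 : (1 : ℝ) < k := by exact_mod_cast hk2
  have hlog := Real.log_pos hk1
  rw [div_le_iff₀ hlog, add_mul, div_mul_cancel₀ _ hlog.ne']
  have hC' : (C : ℝ) ≠ 0 := by exact_mod_cast hC
  have hk0 : (k : ℝ) ^ r ≠ 0 := by positivity
  rw [← Real.log_pow, ← Real.log_mul hC' hk0]
  rcases Nat.eq_zero_or_pos (d k) with h0 | h0
  · rw [h0, Nat.cast_zero, Real.log_zero]
    refine Real.log_nonneg ?_
    have : 1 ≤ C * k ^ r := Nat.pos_of_ne_zero (by positivity)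
    exact_mod_cast this
  · exact Real.log_le_log (by exact_mod_cast h0) (by exact_mod_cast hk)

theorem le_limsup_log_div_log {d : ℕ → ℕ} {r : ℕ} (h : ∀ k, k ^ r ≤ d k) :
    ((r : ℝ) : EReal) ≤
      Filter.limsup (fun k : ℕ => ((Real.log (d k) / Real.log k : ℝ) : EReal)) Filter.atTop := by
  refine Filter.le_limsup_of_frequently_le (Filter.Eventually.frequently ?_)
  filter_upwards [Filter.eventually_ge_atTop 2] with k hk2
  rw [EReal.coe_le_coe_iff]
  have hk1 : (1 : ℝ) < k := by exact_mod_cast hk2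
  rw [le_div_iff₀ (Real.log_pos hk1), ← Real.log_pow]
  exact Real.log_le_log (by positivity) (by exact_mod_cast h k)

/-- A difference of two `n`-th powers of linear polynomials with the same leading coefficient has
degree at most `n - 1`. -/
theorem le_mul_pow_of_add_pow_le {x n c N : ℕ}
    (h : x + (2 * N + 1) ^ n ≤ (2 * (N + c) + 1) ^ n) :
    x ≤ 2 * c * n * (2 * (N + c) + 1) ^ (n - 1) := by
  have key := abs_pow_sub_pow_le ((2 * (N + c) + 1 : ℕ) : ℤ) ((2 * N + 1 : ℕ) : ℤ) n
  have e1 : |((2 * (N + c) + 1 : ℕ) : ℤ) - ((2 * N + 1 : ℕ) : ℤ)| = 2 * c := by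
    rw [abs_of_nonneg] <;> push_cast <;> linarith
  have e2 : max |((2 * (N + c) + 1 : ℕ) : ℤ)| |((2 * N + 1 : ℕ) : ℤ)| =
      ((2 * (N + c) + 1 : ℕ) : ℤ) := by
    rw [Nat.abs_cast, Nat.abs_cast, max_eq_left]
    exact_mod_cast (by omega : 2 * N + 1 ≤ 2 * (N + c) + 1)
  rw [e1, e2] at key
  have h2 := (le_abs_self _).trans key
  zify at h ⊢
  push_cast at h2
  linarith

/-! ### Ranks and infinite cyclic quotients -/

theorem exists_ker_eq_of_infinite_cyclic_quotient {A : Type*} [CommGroup A] (B : Subgroup A)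
    [IsCyclic (A ⧸ B)] [Infinite (A ⧸ B)] :
    ∃ φ : A →* Multiplicative ℤ, Function.Surjective φ ∧ φ.ker = B := by
  refine ⟨(intCyclicMulEquiv (G := A ⧸ B)).symm.toMonoidHom.comp (QuotientGroup.mk' B),
    (intCyclicMulEquiv (G := A ⧸ B)).symm.surjective.comp (QuotientGroup.mk'_surjective B), ?_⟩
  ext a
  simp

theorem groupRk_eq_groupRk_ker_add_one {A : Type*} [CommGroup A] [Group.FG A]
    {φ : A →* Multiplicative ℤ} (hφ : Function.Surjective φ) :
    groupRk A = groupRk φ.ker + 1 := by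
  let f : Additive A →ₗ[ℤ] ℤ := (MonoidHom.toAdditiveLeft φ).toIntLinearMap
  have hf : f.range = ⊤ := LinearMap.range_eq_top.2 hφ
  have h := f.ker.finrank_quotient_add_finrank
  rw [f.quotKerEquivRange.finrank_eq, hf, finrank_top, Module.finrank_self] at h
  let e : Additive φ.ker ≃+ f.ker :=
    { toFun := fun x => ⟨Additive.ofMul (x.toMul : A), x.toMul.2⟩
      invFun := fun x => Additive.ofMul ⟨x.1.toMul, x.2⟩
      left_inv := fun _ => rfl
      right_inv := fun _ => rfl
      map_add' := fun _ _ => rfl }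
  rw [groupRk, groupRk, e.toIntLinearEquiv.finrank_eq, ← h, add_comm]

theorem finite_additive_subgroup {A : Type*} [CommGroup A] [Group.FG A] (B : Subgroup A) :
    Module.Finite ℤ (Additive B) :=
  Module.Finite.of_injective (MonoidHom.toAdditive B.subtype).toIntLinearMap
    Subtype.val_injective

/-! ### Right ideals of `Σ` and their contractions -/

namespace TwistedGroupAlgebra

variable {F A : Type*} [Field F] [CommGroup A] (lam : TwoCocycle F A)

theorem coeff_add (f g : TwistedGroupAlgebra lam) (c : A) :
    coeff (f + g) c = coeff f c + coeff g c :=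
  Finsupp.add_apply _ _ _

theorem coeff_bar_mul (x : A) (f : TwistedGroupAlgebra lam) (c : A) :
    coeff (bar lam x * f) c = lam x (x⁻¹ * c) * coeff f (x⁻¹ * c) := by
  classical
  induction f using induction_on with
  | zero => rw [mul_zero]; exact (mul_zero _).symm
  | add f g hf hg => rw [mul_add, coeff_add, coeff_add, hf, hg, mul_add]
  | single b y =>
    rw [bar, single_mul_single, one_mul]
    by_cases h : x * b = c
    · subst h
      rw [inv_mul_cancel_left]
      exact Finsupp.single_eq_same.trans (congrArg _ Finsupp.single_eq_same.symm)
    · have h' : x⁻¹ * c ≠ b := fun e => h (by rw [← e, mul_inv_cancel_left])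
      exact (Finsupp.single_eq_of_ne (Ne.symm h)).trans
        ((congrArg _ (Finsupp.single_eq_of_ne h')).trans (mul_zero _)).symm

/-- Let `B = ker φ` with `φ : A → ℤ`, and `φ x > 0`. In the grading of `F * A` by `φ`, the components
of `1 + x̄` have two different degrees, so a nonzero multiple of it has components of two different
degrees as well, and cannot lie in `F * B`. -/
theorem one_add_bar_mul_notMem_nonzeroSub [UniqueProds A] {φ : A →* Multiplicative ℤ} {x : A}
    (hx : 1 < φ x) (a : TwistedGroupAlgebra lam) :
    (1 + bar lam x) * a ∉ nonzeroSub lam φ.ker := by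
  classical
  rintro ⟨hs, h0⟩
  have ha : (supp a).Nonempty := Finset.nonempty_iff_ne_empty.2 fun h => h0 (by
    rw [supp_eq_empty.1 h, mul_zero])
  have hcoeff : ∀ c, coeff ((1 + bar lam x) * a) c =
      coeff a c + lam x (x⁻¹ * c) * coeff a (x⁻¹ * c) := by
    intro c
    rw [add_mul, one_mul, coeff_add, coeff_bar_mul]
  obtain ⟨p, hp, hpmax⟩ := (supp a).exists_max_image φ ha
  obtain ⟨q, hq, hqmin⟩ := (supp a).exists_min_image φ ha
  have hzero : ∀ c, c ∉ supp a → coeff a c = 0 := fun c hc => by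
    by_contra h
    exact hc (mem_supp.2 h)
  have hp1 : φ (x * p) = 1 := by
    refine hs _ (mem_supp.2 ?_)
    rw [hcoeff, inv_mul_cancel_left, hzero (x * p), zero_add]
    · exact mul_ne_zero (lam x p).ne_zero (mem_supp.1 hp)
    · intro h
      have := hpmax _ h
      rw [map_mul] at this
      exact absurd hx (not_lt.2 (mul_le_iff_le_one_left'.1 this))
  have hq1 : φ q = 1 := by
    refine hs _ (mem_supp.2 ?_)
    rw [hcoeff, hzero (x⁻¹ * q), mul_zero, add_zero]
    · exact mem_supp.1 hq
    · intro h
      have := hqmin _ h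
      rw [map_mul, map_inv, le_inv_mul_iff_mul_le] at this
      exact absurd hx (not_lt.2 (mul_le_iff_le_one_left'.1 this))
  have h1 := hpmax q hq
  rw [map_mul] at hp1
  rw [hq1] at h1
  exact absurd hp1 (one_lt_mul_of_lt_of_le' hx h1).ne'

/-- If `0` were a maximal right ideal, `Σ` would be a division ring, and an inverse `a s⁻¹` of
`1 + x̄` would give `(1 + x̄) a = s ∈ (F * B) \ {0}`. -/
theorem bot_not_isCoatom [UniqueProds A] {φ : A →* Multiplicative ℤ}
    (hφ : Function.Surjective φ) :
    ¬ IsCoatom (⊥ : Submodule (Sigma lam φ.ker)ᵐᵒᵖ (Sigma lam φ.ker)) := by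
  intro h
  obtain ⟨x, hx⟩ := hφ (Multiplicative.ofAdd 1)
  have hx1 : 1 < φ x := by
    rw [hx]
    exact Multiplicative.ofAdd_lt.2 one_pos
  have key := one_add_bar_mul_notMem_nonzeroSub lam hx1
  set f : TwistedGroupAlgebra lam := 1 + bar lam x
  set j := toSigma lam φ.ker
  have hf : f ≠ 0 := by
    intro h0
    have hx0 : x ≠ 1 := by
      rintro rfl
      exact hx1.ne' (map_one φ)
    have h := congrArg (fun g => coeff g x) h0
    have e : coeff f x = 0 + 1 := (coeff_add lam _ _ x).trans
      (congrArg₂ _ (Finsupp.single_eq_of_ne hx0) Finsupp.single_eq_same)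
    rw [zero_add] at e
    exact one_ne_zero (e.symm.trans h)
  have hspan : Submodule.span (Sigma lam φ.ker)ᵐᵒᵖ {j f} = ⊤ := by
    refine h.2 _ (bot_lt_iff_ne_bot.2 ?_)
    rw [Ne, Submodule.span_singleton_eq_bot]
    exact fun h0 => hf (toSigma_injective lam φ.ker (h0.trans (map_zero _).symm))
  obtain ⟨y, hy⟩ := Submodule.mem_span_singleton.1
    (hspan ▸ Submodule.mem_top : (1 : Sigma lam φ.ker) ∈ _)
  obtain ⟨a, s, has⟩ := sigma_eq_right_fraction lam φ.ker y.unop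
  refine key a ?_
  have : f * a = s := by
    apply toSigma_injective lam φ.ker
    rw [map_mul, ← has, ← mul_assoc]
    change (y • j f) * _ = _
    rw [hy, one_mul]
  exact this ▸ s.2

/-- A nonzero right ideal of `Σ` has nonzero contraction: clear denominators on the right. -/
theorem exists_mem_contractRightIdeal_ne_zero [UniqueProds A] {B : Subgroup A}
    {m : Submodule (Sigma lam B)ᵐᵒᵖ (Sigma lam B)} (hm : m ≠ ⊥) :
    ∃ f ∈ contractRightIdeal (toSigma lam B) m, f ≠ 0 := by
  obtain ⟨y, hy, hy0⟩ := (Submodule.ne_bot_iff _).1 hm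
  obtain ⟨a, s, has⟩ := sigma_eq_right_fraction lam B y
  refine ⟨a, ?_, ?_⟩
  · change toSigma lam B a ∈ m
    rw [← has]
    exact m.smul_mem (MulOpposite.op (toSigma lam B s)) hy
  · rintro rfl
    rw [map_zero] at has
    exact hy0 ((isUnit_toSigma lam B s).mul_left_eq_zero.1 has)

/-- A proper right ideal of `Σ` meets `F * B` only in `0`, as the nonzero elements of `F * B` are
units of `Σ`. -/
theorem eq_zero_of_mem_contractRightIdeal [UniqueProds A] {B : Subgroup A}
    {m : Submodule (Sigma lam B)ᵐᵒᵖ (Sigma lam B)} (hm : m ≠ ⊤) {f : TwistedGroupAlgebra lam}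
    (hf : f ∈ contractRightIdeal (toSigma lam B) m) (hfB : f ∈ sub lam B) : f = 0 := by
  by_contra h0
  obtain ⟨u, hu⟩ := isUnit_toSigma lam B ⟨f, hfB, h0⟩
  refine hm ((Submodule.eq_top_iff').2 fun z => ?_)
  have hf' : (u : Sigma lam B) ∈ m := hu ▸ hf
  have := m.smul_mem (MulOpposite.op (((u⁻¹ : (Sigma lam B)ˣ) : Sigma lam B) * z)) hf'
  rwa [MulOpposite.smul_eq_mul_unop, MulOpposite.unop_op, Units.mul_inv_cancel_left] at this

/-! ### Bounds for the Gelfand--Kirillov dimension -/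

/-- A finite-dimensional subspace lies in the span of a box, so `W V ^ k` lies in the image of the
span of a box of radius linear in `k`, whose dimension is `O(k ^ (n - 1))` by
`finrank_map_quotMap_add_le`. -/
theorem gkDim_quotient_le [UniqueProds A] {n : ℕ} (b : Module.Basis (Fin n) ℤ (Additive A))
    (I : Submodule (TwistedGroupAlgebra lam)ᵐᵒᵖ (TwistedGroupAlgebra lam))
    {f : TwistedGroupAlgebra lam} (hf : f ∈ I) (hf0 : f ≠ 0) :
    gkDim F (TwistedGroupAlgebra lam) (TwistedGroupAlgebra lam ⧸ I) ≤
      (((n - 1 : ℕ) : ℝ) : EReal) := by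
  classical
  refine iSup_le fun V => iSup_le fun _ => iSup_le fun _ => iSup_le fun W => iSup_le fun _ => ?_
  obtain ⟨X, hX⟩ := exists_le_supportedOn lam V
  obtain ⟨d, hd⟩ := exists_subset_latticeBox b X
  obtain ⟨Y, hY⟩ := exists_le_map_quotMap lam I W
  obtain ⟨w, hw⟩ := exists_subset_latticeBox b Y
  obtain ⟨c, hc⟩ := exists_subset_latticeBox b (supp f)
  have hV : V ≤ supportedOn lam (latticeBox b d) := hX.trans (supportedOn_mono lam hd)
  have hsub : ∀ k, growthSubspace V W k ≤
      (supportedOn lam (latticeBox b (w + d * k + c))).map (quotMap lam I) := by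
    intro k
    refine (growthSubspace_le_map_quotMap lam I hY k).trans (Submodule.map_mono ?_)
    refine (mul_le_mul' (supportedOn_mono lam hw) (pow_le_pow_left' hV k)).trans ?_
    rw [supportedOn_pow, supportedOn_mul]
    refine supportedOn_mono lam ((Finset.mul_subset_mul_left (latticeBox_pow_subset b d k)).trans
      ((latticeBox_mul_subset b _ _).trans (latticeBox_mono b (Nat.le_add_right _ _))))
  -- the summand `1` keeps the constant nonzero when `c = 0`
  refine limsup_log_div_log_le (C := 2 * c * n * (2 * (w + d + c) + 1) ^ (n - 1) + 1)
    (Nat.succ_ne_zero _) ?_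
  filter_upwards [Filter.eventually_ge_atTop 1] with k hk
  have h1 := finrank_map_quotMap_add_le lam I b hf hf0 hc (w + d * k)
  rw [Fintype.card_fin] at h1
  have h2 : 2 * (w + d * k + c) + 1 ≤ (2 * (w + d + c) + 1) * k := by nlinarith
  calc Module.finrank F (growthSubspace V W k)
      ≤ Module.finrank F ((supportedOn lam (latticeBox b (w + d * k + c))).map (quotMap lam I)) :=
        Submodule.finrank_mono (hsub k)
    _ ≤ 2 * c * n * (2 * (w + d * k + c) + 1) ^ (n - 1) := le_mul_pow_of_add_pow_le h1
    _ ≤ 2 * c * n * ((2 * (w + d + c) + 1) * k) ^ (n - 1) :=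
        Nat.mul_le_mul_left _ (Nat.pow_le_pow_left h2 _)
    _ ≤ _ := by rw [mul_pow, ← mul_assoc, add_mul]; exact Nat.le_add_right _ _

/-- If `I` meets `F * B` only in `0`, then `F * B` embeds in `(F * A) / I` through the class of `1`,
and the `k`-th power of the span of the box of radius `1` of `B` contains the span of the box of
radius `k`. -/
theorem le_gkDim_quotient {B : Subgroup A} {r : ℕ} (b : Module.Basis (Fin r) ℤ (Additive B))
    (I : Submodule (TwistedGroupAlgebra lam)ᵐᵒᵖ (TwistedGroupAlgebra lam))
    (hI : ∀ f ∈ I, f ∈ sub lam B → f = 0) :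
    ((r : ℝ) : EReal) ≤ gkDim F (TwistedGroupAlgebra lam) (TwistedGroupAlgebra lam ⧸ I) := by
  classical
  set X : Finset A := (latticeBox b 1).image B.subtype
  have h1 : (1 : A) ∈ X := Finset.mem_image.2 ⟨1, one_mem_latticeBox b 1, rfl⟩
  set V := supportedOn lam X
  set W : Submodule F (TwistedGroupAlgebra lam ⧸ I) := Submodule.span F {quotMap lam I 1}
  have hpow : ∀ k, X ^ k = (latticeBox b 1 ^ k).image B.subtype := fun k =>
    (Finset.image_pow B.subtype (latticeBox b 1) k).symm
  have hgrowth : ∀ k, growthSubspace V W k = (supportedOn lam (X ^ k)).map (quotMap lam I) := by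
    intro k
    apply le_antisymm
    · have hW : W ≤ (1 : Submodule F (TwistedGroupAlgebra lam)).map (quotMap lam I) := by
        rw [Submodule.span_le, Set.singleton_subset_iff]
        exact ⟨1, Submodule.one_le.1 le_rfl, rfl⟩
      have := growthSubspace_le_map_quotMap (V := V) lam I hW k
      rwa [one_mul, supportedOn_pow] at this
    · rintro _ ⟨v, hv, rfl⟩
      refine Submodule.subset_span ⟨quotMap lam I 1, Submodule.mem_span_singleton_self _, v, ?_, ?_⟩
      · rw [supportedOn_pow]
        exact hv
      · rw [op_smul_quotMap, one_mul]
  have hfin : ∀ k, Module.finrank F (growthSubspace V W k) = (X ^ k).card := by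
    intro k
    rw [hgrowth, ← finrank_supportedOn lam, ← LinearMap.range_domRestrict]
    refine LinearMap.finrank_range_of_inj ((injective_iff_map_eq_zero _).2 fun f hf => ?_)
    refine Subtype.ext (hI f ((quotMap_eq_zero lam I).1 hf) fun a ha => ?_)
    have := (mem_supportedOn lam).1 f.2 ha
    rw [hpow] at this
    obtain ⟨a', -, rfl⟩ := Finset.mem_image.1 this
    exact a'.2
  refine le_trans ?_ (le_iSup_of_le V (le_iSup_of_le inferInstance
    (le_iSup_of_le (one_mem_supportedOn lam h1) (le_iSup_of_le W (le_iSup_of_le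
      inferInstance le_rfl)))))
  refine le_limsup_log_div_log fun k => ?_
  rw [hfin, hpow, Finset.card_image_of_injective _ B.subtype_injective]
  refine le_trans ?_ (Finset.card_le_card (latticeBox_subset_pow b k))
  rw [card_latticeBox, Fintype.card_fin]
  exact Nat.pow_le_pow_left (by omega) r

end TwistedGroupAlgebra

/-! ### The dimension of the contracted modules -/

open TwistedGroupAlgebra in
theorem mainTheorem7 {F A : Type*} [Field F] [CommGroup A] [Group.FG A] [IsMulTorsionFree A]
    (lam : TwoCocycle F A) (B : Subgroup A) [IsCyclic (A ⧸ B)] [Infinite (A ⧸ B)]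
    (m : Submodule (TwistedGroupAlgebra.Sigma lam B)ᵐᵒᵖ (TwistedGroupAlgebra.Sigma lam B))
    (hm : IsCoatom m) :
    gkDim F (TwistedGroupAlgebra lam) (TwistedGroupAlgebra.contracted lam B m) =
      ((groupRk B : ℝ) : EReal) := by
  obtain ⟨φ, hφ, rfl⟩ := exists_ker_eq_of_infinite_cyclic_quotient B
  have := finite_additive_subgroup φ.ker
  have hm0 : m ≠ ⊥ := fun h => bot_not_isCoatom lam hφ (h ▸ hm)
  obtain ⟨f, hf, hf0⟩ := exists_mem_contractRightIdeal_ne_zero lam hm0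
  apply le_antisymm
  · have h := gkDim_quotient_le lam (Module.finBasis ℤ (Additive A)) _ hf hf0
    have hr : Module.finrank ℤ (Additive A) - 1 = groupRk φ.ker := by
      have := groupRk_eq_groupRk_ker_add_one hφ
      rw [groupRk] at this
      omega
    rwa [hr] at h
  · exact le_gkDim_quotient lam (Module.finBasis ℤ (Additive φ.ker)) _
      fun f hf => eq_zero_of_mem_contractRightIdeal lam hm.1 hf
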